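/- Let $d\ge 1$. For $f,g\in L^2(\mathbb R^d)$ let $$W(f,g)(x,\xi)=\int_{\mathbb R^d} f\left(x+\tfrac t2\right)\overline{g\left(x-\tfrac t2\right)}\,e^{-2\pi i\xi\cdot t}\,dt,\qquad x,\xi\in\mathbb R^d,$$ be the cross-Wigner distribution. Let $S=\begin{pmatrix}A&B\\ C&D\end{pmatrix}\in\mathrm{Sp}(d,\mathbb R)$ with $d\times d$ blocks, and let $\hat S$ be a metaplectic operator with projection $S$, that is, a unitary operator on $L^2(\mathbb R^d)$ such that $W(\hat Sf,\hat Sg)(x,\xi)=W(f,g)(S^{-1}(x,\xi))$ for all $f,g\in L^2(\mathbb R^d)$ and all $(x,\xi)\in\mathbb R^{2d}$. Assume that $1\le \operatorname{rank}(B)\le d$, i.e. $B\ne 0$. Let $M,N\in\mathbb R^{d\times d}$ be symmetric positive-semidefinite matrices with $$\ker(M)=\ker(B),\qquad R(N)=R(B),$$ where $R$ denotes the range. Let $f\in L^2(\mathbb R^d)$, and let $\alpha: D^TA(\ker B)\to[0,\infty]$ and $\beta:A(\ker B)\to[0,\infty]$ be measurable and almost everywhere finite. Assume that for almost every $x_2\in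 D^TA(\ker B)$ $$|f(x_1+x_2)|\le\alpha(x_2)\,e^{-\pi Mx_1\cdot x_1}\qquad\text{for almost every } x_1\in\ker(B)^\perp,$$ and that for almost every $\xi_2\in A(\ker B)$ $$|\hat Sf(\xi_1+\xi_2)|\le\beta(\xi_2)\,e^{-\pi N\xi_1\cdot\xi_1}\qquad\text{for almost every } \xi_1\in R(B),$$ where each of these subspaces carries its own Lebesgue measure (the unit point mass if the subspace is $\{0\}$). If the matrix $MB^TNB$ has an eigenvalue $\lambda>1$, then $f=0$ almost everywhere. -/

import Mathlib

open MeasureTheory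

noncomputable section

/-- `ℝ^d` with its Euclidean structure. -/
abbrev Euc (d : ℕ) : Type := EuclideanSpace ℝ (Fin d)

/-- `L²(ℝ^d)`, complex valued, with respect to Lebesgue measure. -/
abbrev L2Space (d : ℕ) : Type := Lp ℂ 2 (volume : Measure (Euc d))

/-- The cross-Wigner distribution
`W(f,g)(x,ξ) = ∫ f(x + t/2) conj(g(x - t/2)) e^{-2πi ξ·t} dt`. -/
def crossWigner {d : ℕ} (f g : Euc d → ℂ) (x ξ : Euc d) : ℂ :=
  ∫ t : Euc d, f (x + (1 / 2 : ℝ) • t) * starRingEnd ℂ (g (x - (1 / 2 : ℝ) • t)) *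
    Complex.exp (-2 * Real.pi * Complex.I * (inner ℝ ξ t : ℝ))

/-- The linear action of a `2d × 2d` matrix on phase space `ℝ^d × ℝ^d`. -/
def phaseAct {d : ℕ} (S : Matrix (Fin d ⊕ Fin d) (Fin d ⊕ Fin d) ℝ)
    (x ξ : Euc d) : Euc d × Euc d :=
  (WithLp.toLp 2 fun i => S.mulVec (Sum.elim x ξ) (Sum.inl i),
   WithLp.toLp 2 fun i => S.mulVec (Sum.elim x ξ) (Sum.inr i))

/-- `T` is a metaplectic operator with projection `S`: `S` is symplectic, and the unitary operator
`T` on `L²(ℝ^d)` satisfies `W(Tf,Tg)(x,ξ) = W(f,g)(S⁻¹(x,ξ))` for all `f, g, x, ξ`. -/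
def IsMetaplectic {d : ℕ} (S : Matrix (Fin d ⊕ Fin d) (Fin d ⊕ Fin d) ℝ)
    (T : L2Space d ≃ₗᵢ[ℂ] L2Space d) : Prop :=
  S ∈ Matrix.symplecticGroup (Fin d) ℝ ∧
  ∀ (f g : L2Space d) (x ξ : Euc d),
    crossWigner (T f) (T g) x ξ = crossWigner f g (phaseAct S⁻¹ x ξ).1 (phaseAct S⁻¹ x ξ).2

/-- The kernel of a matrix, as a subspace of `ℝ^d`. -/
def matKer {d : ℕ} (E : Matrix (Fin d) (Fin d) ℝ) : Submodule ℝ (Euc d) :=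
  LinearMap.ker (Matrix.toEuclideanLin E)

/-- The range of a matrix, as a subspace of `ℝ^d`. -/
def matRange {d : ℕ} (E : Matrix (Fin d) (Fin d) ℝ) : Submodule ℝ (Euc d) :=
  LinearMap.range (Matrix.toEuclideanLin E)

/-- The image `E(L)` of a subspace `L` under a matrix `E`. -/
def matImage {d : ℕ} (E : Matrix (Fin d) (Fin d) ℝ) (L : Submodule ℝ (Euc d)) :
    Submodule ℝ (Euc d) :=
  L.map (Matrix.toEuclideanLin E)

/-- The quadratic form `Ex · x`. -/
def matQuad {d : ℕ} (E : Matrix (Fin d) (Fin d) ℝ) (x : Euc d) : ℝ :=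
  inner ℝ (Matrix.toEuclideanLin E x) x

/-- The Lebesgue measure of a subspace `L` of `ℝ^d` (of its own dimension), normalized so that
the cube spanned by an orthonormal basis of `L` has measure one. -/
def lebesgueOn {d : ℕ} (L : Submodule ℝ (Euc d)) : Measure L :=
  (stdOrthonormalBasis ℝ L).toBasis.addHaar

end

open MeasureTheory

noncomputable section

/-! The theorem is Hardy's uncertainty principle in the single direction singled out by the
eigenvector. If `w` is an eigenvector for `λ > 1`, then `w = My₀` with `My₀·y₀ < N(Bw)·(Bw)`
(`exists_matQuad_lt_of_hasEigenvalue`). Covariance of the Wigner distribution says that modulation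
by `w` turns into the phase-space shift by `(Bw, Dw)`. So `z ↦ ∫ h ḡ e^{-2πi z w·x}` is entire with
growth governed by the decay of `g`, while for real `z` it is an ambiguity function of `Th` and
`Tg`, governed by the decay of `Tg` along `Bw`. The strict inequality and Phragmén–Lindelöf
(`eq_zero_of_gaussian_bounds`) force it to vanish at `0`. With `Th` a truncation of `Tg`, its value
there is the squared norm of `Th`, so the truncation is zero.

The factors `α`, `β` need not be bounded, so `f` is first cut off in its `ker B`-coordinate. For `w
∈ ker B` the shift `Bw` vanishes, hence `T` preserves the energy distribution along `ker B` and
commutes with such cutoffs (`IsMetaplectic.map_cutoff`). The cut-off function keeps both Gaussian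
bounds, and letting the cutoffs exhaust space gives `f = 0`. -/

/-! ### Hardy-type vanishing by Phragmén–Lindelöf. -/

lemma norm_mul_cexp_sq (F : ℂ → ℂ) (c : ℝ) (z : ℂ) :
    ‖F z * Complex.exp (c * z ^ 2)‖ = ‖F z‖ * Real.exp (c * (z.re ^ 2 - z.im ^ 2)) := by
  rw [norm_mul, Complex.norm_exp]
  congr 2
  simp [pow_two]

/-- A function of Gaussian growth in the imaginary direction and stronger Gaussian decay on the
real axis is bounded on the first quadrant after multiplication by an intermediate Gaussian. -/
lemma norm_mul_cexp_sq_le_of_quadrant {F : ℂ → ℂ} (hF : Differentiable ℂ F) {a b c K : ℝ}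
    (hb : 0 ≤ b) (hbc : b < c) (hca : c < a) (hreal : ∀ x : ℝ, ‖F x‖ ≤ K * Real.exp (-a * x ^ 2))
    (hgrowth : ∀ z : ℂ, ‖F z‖ ≤ K * Real.exp (b * z.im ^ 2)) {z : ℂ}
    (hre : 0 ≤ z.re) (him : 0 ≤ z.im) : ‖F z * Complex.exp (c * z ^ 2)‖ ≤ K := by
  have hK : 0 ≤ K := by
    have := (norm_nonneg _).trans (hreal 0)
    simpa using this
  have hc : 0 < c := by linarith
  set G : ℂ → ℂ := fun z => F z * Complex.exp (c * z ^ 2) with hG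
  have hGd : Differentiable ℂ G := by fun_prop
  have hsteep : ∀ z : ℂ, c * z.re ^ 2 ≤ (c - b) * z.im ^ 2 → ‖G z‖ ≤ K := by
    intro z hz
    simp only [hG]
    rw [norm_mul_cexp_sq]
    calc _ ≤ (K * Real.exp (b * z.im ^ 2)) * Real.exp (c * (z.re ^ 2 - z.im ^ 2)) := by
          gcongr; exact hgrowth z
      _ = K * Real.exp (b * z.im ^ 2 + c * (z.re ^ 2 - z.im ^ 2)) := by
          rw [Real.exp_add]; ring
      _ ≤ K * 1 := by
          gcongr
          rw [Real.exp_le_one_iff]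
          linarith
      _ = K := mul_one K
  have haxis : ∀ x : ℝ, ‖G x‖ ≤ K := by
    intro x
    simp only [hG]
    rw [norm_mul_cexp_sq]
    calc _ ≤ (K * Real.exp (-a * x ^ 2)) * Real.exp (c * ((x : ℂ).re ^ 2 - (x : ℂ).im ^ 2)) := by
          gcongr; exact hreal x
      _ = K * Real.exp (-((a - c) * x ^ 2)) := by
          rw [mul_assoc, ← Real.exp_add]; congr 2; simp; ring
      _ ≤ K * 1 := by
          gcongr
          rw [Real.exp_le_one_iff, neg_nonpos]
          have : 0 < a - c := by linarith
          positivity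
      _ = K := mul_one K
  -- `κ` is the cosine of the critical angle where `c cos² θ = (c - b) sin² θ`: at steeper angles
  -- the growth hypothesis alone bounds `G`. The remaining sector has opening less than `π / 2`.
  set κ : ℝ := Real.sqrt ((c - b) / (2 * c - b)) with hκ
  have hden : 0 < 2 * c - b := by linarith
  have hκpos : 0 < κ := Real.sqrt_pos.2 (div_pos (by linarith) hden)
  have hκsq : κ ^ 2 = (c - b) / (2 * c - b) := Real.sq_sqrt (div_nonneg (by linarith) hden.le)
  have hκlt : κ < 1 := by
    rw [hκ, Real.sqrt_lt' one_pos, div_lt_iff₀ hden]; linarith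
  have hcone : ∀ θ : ℝ, Real.cos θ ^ 2 ≤ κ ^ 2 →
      c * Real.cos θ ^ 2 ≤ (c - b) * Real.sin θ ^ 2 := by
    intro θ hθ
    rw [hκsq, le_div_iff₀ hden] at hθ
    rw [Real.sin_sq]
    nlinarith
  have hpolar : ∀ r θ : ℝ, Real.cos θ ^ 2 ≤ κ ^ 2 →
      ∀ z : ℂ, z.re = r * Real.cos θ → z.im = r * Real.sin θ → ‖G z‖ ≤ K := by
    intro r θ hθ z h1 h2
    apply hsteep
    rw [h1, h2]
    have := mul_le_mul_of_nonneg_left (hcone θ hθ) (sq_nonneg r)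
    nlinarith
  set θ₀ : ℝ := Real.arccos κ with hθ₀
  have hθ₀cos : Real.cos θ₀ = κ := Real.cos_arccos (by linarith) hκlt.le
  have hθ₀pos : 0 < θ₀ := Real.arccos_pos.2 hκlt
  have hθ₀lt : θ₀ < Real.pi / 2 := Real.arccos_lt_pi_div_two.2 hκpos
  rcases eq_or_ne z 0 with rfl | hz
  · simpa only [Complex.ofReal_zero] using haxis 0
  have hargnn : 0 ≤ z.arg := Complex.arg_nonneg_iff.2 him
  have hargle : z.arg ≤ Real.pi / 2 := Complex.arg_le_pi_div_two_iff.2 (Or.inl hre)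
  rcases le_total z.arg θ₀ with harg | harg
  · have key : ‖(fun ζ => G (Complex.exp ζ)) (Complex.log z)‖ ≤ K := by
      refine PhragmenLindelof.horizontal_strip (a := 0) (b := θ₀) (f := fun ζ => G (Complex.exp ζ))
        (Differentiable.diffContOnCl (by fun_prop)) ⟨2, ?_, b + c, ?_⟩ ?_ ?_ ?_ ?_
      -- In logarithmic coordinates `G` has order 2, and `θ₀ < π / 2` gives exactly `2 < π / θ₀`.
      · rw [sub_zero, lt_div_iff₀ hθ₀pos]; linarith
      · refine Asymptotics.IsBigO.of_bound K (Filter.Eventually.of_forall fun ζ => ?_)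
        simp only [hG]
        rw [norm_mul_cexp_sq, Real.norm_eq_abs, Real.abs_exp]
        set y := Complex.exp ζ with hy
        have hn : y.re ^ 2 + y.im ^ 2 ≤ Real.exp (2 * |ζ.re|) := by
          have h1 : y.re ^ 2 + y.im ^ 2 = ‖y‖ ^ 2 := by
            rw [← Complex.normSq_eq_norm_sq, Complex.normSq_apply]; ring
          rw [h1, hy, Complex.norm_exp, ← Real.exp_nat_mul]
          refine Real.exp_le_exp.2 ?_
          push_cast
          linarith [le_abs_self ζ.re]
        calc _ ≤ (K * Real.exp (b * y.im ^ 2)) * Real.exp (c * (y.re ^ 2 - y.im ^ 2)) := by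
              gcongr; exact hgrowth y
          _ = K * Real.exp (b * y.im ^ 2 + c * (y.re ^ 2 - y.im ^ 2)) := by
              rw [Real.exp_add]; ring
          _ ≤ _ := by
              gcongr
              have := mul_le_mul_of_nonneg_left hn (by linarith : 0 ≤ b + c)
              nlinarith [mul_nonneg hb (sq_nonneg y.re), mul_nonneg hc.le (sq_nonneg y.im)]
      · intro ζ hζ
        have : Complex.exp ζ = ((Real.exp ζ.re : ℝ) : ℂ) := by
          apply Complex.ext <;> simp [Complex.exp_re, Complex.exp_im, hζ,
            -Complex.ofReal_exp]
        simp only [this]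
        exact haxis _
      · intro ζ hζ
        exact hpolar (Real.exp ζ.re) ζ.im (by rw [hζ, hθ₀cos]) _ (Complex.exp_re ζ)
          (Complex.exp_im ζ)
      · rw [Complex.log_im]; exact hargnn
      · rw [Complex.log_im]; exact harg
    simpa only [Complex.exp_log hz] using key
  · refine hpolar ‖z‖ z.arg ?_ z (Complex.norm_mul_cos_arg z).symm (Complex.norm_mul_sin_arg z).symm
    have h1 : Real.cos z.arg ≤ κ := by
      rw [← hθ₀cos]
      exact Real.cos_le_cos_of_nonneg_of_le_pi hθ₀pos.le (by linarith [Real.pi_pos]) harg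
    have h2 : 0 ≤ Real.cos z.arg :=
      Real.cos_nonneg_of_neg_pi_div_two_le_of_le (by linarith [Real.pi_pos]) hargle
    gcongr

/-- Hardy-type vanishing: an entire function that grows at most like `exp (b y²)` in the imaginary
direction and decays like `exp (-a x²)` on the real axis, `b < a`, vanishes at the origin. -/
lemma eq_zero_of_gaussian_bounds {F : ℂ → ℂ} (hF : Differentiable ℂ F) {a b K : ℝ}
    (hb : 0 ≤ b) (hba : b < a) (hreal : ∀ x : ℝ, ‖F x‖ ≤ K * Real.exp (-a * x ^ 2))
    (hgrowth : ∀ z : ℂ, ‖F z‖ ≤ K * Real.exp (b * z.im ^ 2)) : F 0 = 0 := by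
  -- Multiplication by `exp (c z²)` makes `F` bounded on each quadrant, the others following by
  -- conjugation and `z ↦ -z`. Liouville makes the product constant, and `c < a` makes it tend to
  -- `0` along the real axis.
  obtain ⟨c, hbc, hca⟩ := exists_between hba
  set G : ℂ → ℂ := fun z => F z * Complex.exp (c * z ^ 2) with hG
  have hGd : Differentiable ℂ G := by fun_prop
  have upper : ∀ (H : ℂ → ℂ), Differentiable ℂ H →
      (∀ x : ℝ, ‖H x‖ ≤ K * Real.exp (-a * x ^ 2)) →
      (∀ z : ℂ, ‖H z‖ ≤ K * Real.exp (b * z.im ^ 2)) → ∀ z : ℂ, 0 ≤ z.re →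
      ‖H z * Complex.exp (c * z ^ 2)‖ ≤ K := by
    intro H hH h1 h2 z hz
    rcases le_total 0 z.im with him | him
    · exact norm_mul_cexp_sq_le_of_quadrant hH hb hbc hca h1 h2 hz him
    · have := norm_mul_cexp_sq_le_of_quadrant
        (F := fun z => starRingEnd ℂ (H (starRingEnd ℂ z))) (a := a) (b := b) (c := c) (K := K)
        (fun z => by
          have := (hH (starRingEnd ℂ z)).conj_conj
          simpa [Function.comp_def] using this) hb hbc hca
        (fun x => by simpa using h1 x)
        (fun z => by simpa using h2 (starRingEnd ℂ z)) (z := starRingEnd ℂ z)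
        (by simpa using hz) (by simpa using him)
      rw [norm_mul_cexp_sq (F := fun z => starRingEnd ℂ (H (starRingEnd ℂ z)))] at this
      rw [norm_mul_cexp_sq]
      simpa using this
  have hbdd : ∀ z, ‖G z‖ ≤ K := by
    intro z
    rcases le_total 0 z.re with hz | hz
    · exact upper F hF hreal hgrowth z hz
    · have := upper (fun z => F (-z)) (by fun_prop)
        (fun x => by simpa using hreal (-x)) (fun z => by simpa using hgrowth (-z)) (-z)
        (by simpa using hz)
      simpa [hG] using this
  have hconst : ∀ x : ℝ, G x = G 0 := fun x =>
    hGd.apply_eq_apply_of_bounded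
      (isBounded_iff_forall_norm_le.2 ⟨K, by rintro _ ⟨z, rfl⟩; exact hbdd z⟩) _ _
  have hlim : Filter.Tendsto (fun x : ℝ => K * Real.exp (-((a - c) * x ^ 2))) Filter.atTop
      (nhds (K * 0)) := by
    refine Filter.Tendsto.const_mul _ (Real.tendsto_exp_neg_atTop_nhds_zero.comp ?_)
    exact (Filter.tendsto_pow_atTop two_ne_zero).const_mul_atTop (by linarith)
  have hG0 : ‖G 0‖ ≤ K * 0 := by
    refine ge_of_tendsto' hlim fun x => ?_
    rw [← hconst x]
    simp only [hG]
    rw [norm_mul_cexp_sq]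
    calc _ ≤ (K * Real.exp (-a * x ^ 2)) * Real.exp (c * ((x : ℂ).re ^ 2 - (x : ℂ).im ^ 2)) := by
          gcongr; exact hreal x
      _ = _ := by
          rw [mul_assoc, ← Real.exp_add]; congr 2; simp; ring
  have : G 0 = 0 := by simpa using hG0
  simpa [hG] using this

/-! ### Parity, ambiguity functions and the weak intertwining relation. -/

/-- The parity operator `f ↦ f (-·)` on `L²(ℝ^d)`. -/
def parity {d : ℕ} (f : L2Space d) : L2Space d :=
  Lp.compMeasurePreserving (fun x : Euc d => -x) (Measure.measurePreserving_neg volume) f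

lemma coeFn_parity {d : ℕ} (f : L2Space d) : parity f =ᵐ[volume] fun x => f (-x) :=
  Lp.coeFn_compMeasurePreserving f _

lemma quasiMeasurePreserving_sub_smul {d : ℕ} (x : Euc d) {r : ℝ} (hr : r ≠ 0) :
    Measure.QuasiMeasurePreserving (fun t : Euc d => x - r • t) := by
  have h1 : Measure.QuasiMeasurePreserving (fun t : Euc d => r • t) volume volume := by
    refine ⟨measurable_const_smul r, ?_⟩
    rw [Measure.map_addHaar_smul volume hr]
    exact Measure.smul_absolutelyContinuous
  exact (Measure.measurePreserving_sub_left volume x).quasiMeasurePreserving.comp h1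

/-- Up to the factor `2^d`, the cross-Wigner distribution of `f` and the reflection of `g` is the
cross-ambiguity function of `f` and `g`. -/
lemma crossWigner_parity {d : ℕ} (f g : L2Space d) (x ξ : Euc d) :
    crossWigner f (parity g) x ξ = ((2 : ℝ) ^ d) • ∫ s : Euc d, f (s + x) *
      starRingEnd ℂ (g (s - x)) *
        Complex.exp (-2 * Real.pi * Complex.I * (inner ℝ ((2 : ℝ) • ξ) s : ℝ)) := by
  set H : Euc d → ℂ := fun s => f (s + x) * starRingEnd ℂ (g (s - x)) *
    Complex.exp (-2 * Real.pi * Complex.I * (inner ℝ ((2 : ℝ) • ξ) s : ℝ)) with hH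
  have h1 : crossWigner f (parity g) x ξ = ∫ t : Euc d, H ((1 / 2 : ℝ) • t) := by
    refine integral_congr_ae ?_
    have h := (quasiMeasurePreserving_sub_smul x (r := 1 / 2) (by norm_num)).ae (coeFn_parity g)
    filter_upwards [h] with t ht
    rw [ht]
    simp only [hH, neg_sub, inner_smul_left, inner_smul_right]
    rw [add_comm x]
    simp
  rw [h1, Measure.integral_comp_smul volume H (1 / 2 : ℝ)]
  congr 1
  simp

lemma crossWigner_parity_zero {d : ℕ} (f g : L2Space d) :
    crossWigner f (parity g) 0 0 = ((2 : ℝ) ^ d) • inner ℂ g f := by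
  rw [crossWigner_parity, L2.inner_def]
  simp

lemma phaseAct_zero {d : ℕ} (S : Matrix (Fin d ⊕ Fin d) (Fin d ⊕ Fin d) ℝ) :
    phaseAct S 0 0 = (0, 0) := by
  have : Sum.elim (0 : Euc d) (0 : Euc d) = (0 : Fin d ⊕ Fin d → ℝ) := by
    ext i; cases i <;> rfl
  unfold phaseAct
  rw [this]
  simp only [Matrix.mulVec_zero]
  rfl

lemma phaseAct_inv_phaseAct {d : ℕ} {S : Matrix (Fin d ⊕ Fin d) (Fin d ⊕ Fin d) ℝ}
    (hS : IsUnit S.det) (x ξ : Euc d) :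
    phaseAct S⁻¹ (phaseAct S x ξ).1 (phaseAct S x ξ).2 = (x, ξ) := by
  have : Sum.elim (phaseAct S x ξ).1 (phaseAct S x ξ).2 = S.mulVec (Sum.elim x ξ) := by
    ext i; cases i <;> rfl
  unfold phaseAct at *
  rw [this, Matrix.mulVec_mulVec, Matrix.nonsing_inv_mul _ hS, Matrix.one_mulVec]
  rfl

lemma phaseAct_fromBlocks_zero_left {d : ℕ} (A B C D : Matrix (Fin d) (Fin d) ℝ) (ξ : Euc d) :
    phaseAct (Matrix.fromBlocks A B C D) 0 ξ =
      (Matrix.toEuclideanLin B ξ, Matrix.toEuclideanLin D ξ) := by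
  unfold phaseAct
  rw [Matrix.fromBlocks_mulVec]
  have h1 : (Sum.elim (0 : Euc d) ξ) ∘ Sum.inl = (0 : Fin d → ℝ) := rfl
  have h2 : (Sum.elim (0 : Euc d) ξ) ∘ Sum.inr = (ξ : Fin d → ℝ) := rfl
  rw [h1, h2]
  simp only [Matrix.mulVec_zero, zero_add, Sum.elim_inl, Sum.elim_inr]
  rfl

/-- The origin is fixed by `S`, and the Wigner value there of `f` and the reflected `g` is `2^d`
times an inner product. Covariance at the origin thus identifies the inner products of `parity (T
(parity g))` and of `T g` with every `T f`. -/
lemma IsMetaplectic.map_parity {d : ℕ} {S : Matrix (Fin d ⊕ Fin d) (Fin d ⊕ Fin d) ℝ}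
    {T : L2Space d ≃ₗᵢ[ℂ] L2Space d} (hT : IsMetaplectic S T) (g : L2Space d) :
    T (parity g) = parity (T g) := by
  have hinv : ∀ u : L2Space d, parity (parity u) = u := by
    intro u
    refine Lp.ext ?_
    filter_upwards [coeFn_parity (parity u),
      (Measure.measurePreserving_neg (volume : Measure (Euc d))).quasiMeasurePreserving.ae
        (coeFn_parity u)] with x h1 h2
    rw [h1, h2, neg_neg]
  have key : parity (T (parity g)) = T g := by
    refine ext_inner_right ℂ fun v => ?_
    obtain ⟨f, rfl⟩ := T.surjective v
    have h := hT.2 f (parity g) 0 0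
    rw [phaseAct_zero, crossWigner_parity_zero, ← hinv (T (parity g)),
      crossWigner_parity_zero] at h
    rw [T.inner_map_map]
    exact smul_right_injective ℂ (by positivity : (2 : ℝ) ^ d ≠ 0) h
  rw [← key, hinv]

/-- A metaplectic operator intertwines the modulation by `w` with the phase-space shift by
`(Bw, Dw)`, in weak form. -/
lemma IsMetaplectic.integral_mul_conj_mul_exp {d : ℕ} {A B C D : Matrix (Fin d) (Fin d) ℝ}
    {T : L2Space d ≃ₗᵢ[ℂ] L2Space d} (hT : IsMetaplectic (Matrix.fromBlocks A B C D) T)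
    (f g : L2Space d) (w : Euc d) :
    ∫ x : Euc d, f x * starRingEnd ℂ (g x) *
        Complex.exp (-2 * Real.pi * Complex.I * (inner ℝ w x : ℝ)) =
      ∫ y : Euc d, (T f) (y + (1 / 2 : ℝ) • Matrix.toEuclideanLin B w) *
        starRingEnd ℂ ((T g) (y - (1 / 2 : ℝ) • Matrix.toEuclideanLin B w)) *
        Complex.exp (-2 * Real.pi * Complex.I * (inner ℝ (Matrix.toEuclideanLin D w) y : ℝ)) := by
  have hS := SymplecticGroup.symplectic_det hT.1
  -- The point `S(0, w/2) = (Bw/2, Dw/2)` is used because the passage to the ambiguity function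
  -- doubles frequencies.
  have h := hT.2 f (parity g) (phaseAct (Matrix.fromBlocks A B C D) 0 ((1 / 2 : ℝ) • w)).1
    (phaseAct (Matrix.fromBlocks A B C D) 0 ((1 / 2 : ℝ) • w)).2
  rw [phaseAct_inv_phaseAct hS, hT.map_parity, crossWigner_parity, crossWigner_parity,
    phaseAct_fromBlocks_zero_left] at h
  have h' := smul_right_injective ℂ (by positivity : (2 : ℝ) ^ d ≠ 0) h
  simp only [map_smul, smul_smul, add_zero, sub_zero] at h'
  norm_num only [one_smul] at h'
  exact h'.symm

/-! ### Almost-everywhere statements on slices. -/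

instance isAddHaarMeasure_lebesgueOn {d : ℕ} (L : Submodule ℝ (Euc d)) :
    (lebesgueOn L).IsAddHaarMeasure := by
  unfold lebesgueOn; infer_instance

/-- A property that holds almost everywhere on almost every slice parallel to `L₁` holds almost
everywhere on the ambient space. -/
lemma ae_exists_add_of_isCompl {d : ℕ} {L₁ L₂ : Submodule ℝ (Euc d)} (h : IsCompl L₁ L₂)
    {p : L₂ → L₁ → Prop} (hp : MeasurableSet {z : L₂ × L₁ | p z.1 z.2})
    (hae : ∀ᵐ x₂ ∂lebesgueOn L₂, ∀ᵐ x₁ ∂lebesgueOn L₁, p x₂ x₁) :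
    ∀ᵐ x : Euc d, ∃ (x₁ : L₁) (x₂ : L₂), x = (x₁ : Euc d) + (x₂ : Euc d) ∧ p x₂ x₁ := by
  have h1 : ∀ᵐ z ∂(lebesgueOn L₂).prod (lebesgueOn L₁), p z.1 z.2 :=
    (Measure.ae_prod_iff_ae_ae hp).2 hae
  set e : (L₂ × L₁) ≃L[ℝ] Euc d :=
    (Submodule.prodEquivOfIsCompl L₂ L₁ h.symm).toContinuousLinearEquiv with he
  -- Haar measures on the product share their null sets, so the Jacobian of a possibly oblique
  -- decomposition is irrelevant.
  have h2 : (Measure.map e.symm (volume : Measure (Euc d))) ≪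
      (lebesgueOn L₂).prod (lebesgueOn L₁) :=
    Measure.absolutelyContinuous_isAddHaarMeasure _ _
  have h3 := ae_of_ae_map e.symm.continuous.measurable.aemeasurable (h2.ae_le h1)
  filter_upwards [h3] with x hx
  refine ⟨(e.symm x).2, (e.symm x).1, ?_, hx⟩
  have : e (e.symm x) = x := e.apply_symm_apply x
  conv_lhs => rw [← this]
  rw [add_comm]
  rfl

/-! ### Gaussian integrability and Fourier–Laplace transforms. -/

lemma integrable_exp_neg_mul_norm_sq {d : ℕ} {c : ℝ} (hc : 0 < c) :
    Integrable (fun x : Euc d => Real.exp (-c * ‖x‖ ^ 2)) := by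
  have h := (GaussianFourier.integrable_cexp_neg_mul_sq_norm_add (V := Euc d) (b := (c : ℂ))
    (by simpa using hc) 0 0).norm
  refine h.congr (Filter.Eventually.of_forall fun x => ?_)
  simp only [Complex.norm_exp]
  congr 1
  norm_cast
  simp

lemma integrable_exp_neg_mul_norm_sq_mul_norm {d : ℕ} {c : ℝ} (hc : 0 < c) (h : L2Space d) :
    Integrable (fun x : Euc d => Real.exp (-c * ‖x‖ ^ 2) * ‖h x‖) := by
  have h1 : MemLp (fun x : Euc d => Real.exp (-c * ‖x‖ ^ 2)) 2 volume := by
    rw [memLp_two_iff_integrable_sq (by fun_prop)]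
    refine (integrable_exp_neg_mul_norm_sq (d := d) (c := 2 * c) (by positivity)).congr
      (Filter.Eventually.of_forall fun x => ?_)
    simp only [← Real.exp_nat_mul]
    congr 1
    push_cast
    ring
  exact h1.integrable_mul (Lp.memLp h).norm

/-- The Fourier–Laplace transform of a density with all exponential moments is entire. -/
lemma differentiable_integral_mul_cexp {X : Type*} [MeasurableSpace X] {μ : Measure X}
    {ρ : X → ℂ} {l : X → ℝ} (hρ : AEStronglyMeasurable ρ μ) (hl : Measurable l)
    (hmoment : ∀ R : ℝ, Integrable (fun x => ‖ρ x‖ * Real.exp (R * |l x|)) μ) :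
    Differentiable ℂ fun z : ℂ =>
      ∫ x, ρ x * Complex.exp (-2 * Real.pi * Complex.I * (z * l x)) ∂μ := by
  intro z₀
  have hnorm : ∀ (z : ℂ) (x : X), ‖Complex.exp (-2 * Real.pi * Complex.I * (z * l x))‖ ≤
      Real.exp (2 * Real.pi * ‖z‖ * |l x|) := by
    intro z x
    refine (Complex.norm_exp_le_exp_norm _).trans_eq ?_
    congr 1
    simp [abs_of_pos Real.pi_pos, mul_assoc]
  have hmeas : ∀ z : ℂ, AEStronglyMeasurable
      (fun x => ρ x * Complex.exp (-2 * Real.pi * Complex.I * (z * l x))) μ := by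
    intro z
    exact hρ.mul (by fun_prop)
  refine (hasDerivAt_integral_of_dominated_loc_of_deriv_le (μ := μ) (s := Metric.ball z₀ 1)
    (F := fun z x => ρ x * Complex.exp (-2 * Real.pi * Complex.I * (z * l x)))
    (F' := fun z x => ρ x * (Complex.exp (-2 * Real.pi * Complex.I * (z * l x)) *
      (-2 * Real.pi * Complex.I * l x)))
    -- On the unit ball `‖z‖ ≤ ‖z₀‖ + 1`; the extra `2π` in the exponent absorbs the factor `2π |l
    -- x|` from differentiation.
    (bound := fun x => ‖ρ x‖ * Real.exp ((2 * Real.pi * (‖z₀‖ + 1) + 2 * Real.pi) * |l x|))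
    (Metric.ball_mem_nhds z₀ one_pos) (Filter.Eventually.of_forall hmeas) ?_ ?_ ?_ (hmoment _)
    ?_).2.differentiableAt
  · refine (hmoment (2 * Real.pi * ‖z₀‖)).mono' (hmeas z₀) (Filter.Eventually.of_forall fun x => ?_)
    rw [norm_mul]
    gcongr
    exact hnorm z₀ x
  · exact hρ.mul (by fun_prop)
  · refine Filter.Eventually.of_forall fun x z hz => ?_
    rw [norm_mul, norm_mul]
    gcongr
    rw [add_mul, Real.exp_add]
    have hz' : ‖z‖ ≤ ‖z₀‖ + 1 := by
      have h1 : ‖z - z₀‖ < 1 := by simpa [dist_eq_norm] using hz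
      have h2 := norm_le_norm_add_norm_sub z₀ z
      rw [norm_sub_rev] at h2
      linarith
    gcongr
    · refine (hnorm z x).trans ?_
      gcongr
    · have h1 : ‖-2 * (Real.pi : ℂ) * Complex.I * (l x : ℂ)‖ = 2 * Real.pi * |l x| := by
        simp [abs_of_pos Real.pi_pos]
      rw [h1]
      linarith [Real.add_one_le_exp (2 * Real.pi * |l x|)]
  · refine Filter.Eventually.of_forall fun x z _ => ?_
    have h1 : HasDerivAt (fun z : ℂ => -2 * Real.pi * Complex.I * (z * l x))
        (-2 * Real.pi * Complex.I * l x) z := by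
      simpa using ((hasDerivAt_id z).mul_const (l x : ℂ)).const_mul
        (-2 * Real.pi * Complex.I)
    exact h1.cexp.const_mul (ρ x)

/-! ### Linear algebra of symplectic blocks. -/

lemma toEuclideanLin_mul_apply {d : ℕ} (E F : Matrix (Fin d) (Fin d) ℝ) (x : Euc d) :
    Matrix.toEuclideanLin (E * F) x = Matrix.toEuclideanLin E (Matrix.toEuclideanLin F x) := by
  simp [Matrix.toLpLin_apply, Matrix.mulVec_mulVec]

lemma inner_toEuclideanLin_left {d : ℕ} (E : Matrix (Fin d) (Fin d) ℝ) (x y : Euc d) :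
    inner ℝ (Matrix.toEuclideanLin E x) y = inner ℝ x (Matrix.toEuclideanLin E.transpose y) := by
  rw [← Matrix.conjTranspose_eq_transpose_of_trivial,
    Matrix.toEuclideanLin_conjTranspose_eq_adjoint, LinearMap.adjoint_inner_right]

lemma orthogonal_matKer {d : ℕ} (E : Matrix (Fin d) (Fin d) ℝ) :
    (matKer E)ᗮ = matRange E.transpose := by
  have h : (matRange E.transpose)ᗮ = matKer E := by
    ext x
    rw [Submodule.mem_orthogonal']
    constructor
    · intro hx
      refine LinearMap.mem_ker.2 (ext_inner_right ℝ fun y => ?_)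
      rw [inner_toEuclideanLin_left, hx _ ⟨y, rfl⟩, inner_zero_left]
    · rintro hx _ ⟨y, rfl⟩
      rw [← inner_toEuclideanLin_left, LinearMap.mem_ker.1 hx, inner_zero_left]
  rw [← h, Submodule.orthogonal_orthogonal]

/-- Criterion for the image of `K` under `E` to be a complement of `L`, by means of a retraction
of `E` that vanishes on `L`. -/
lemma isCompl_map_of_retraction {V : Type*} [AddCommGroup V] [Module ℝ V] {K L : Submodule ℝ V}
    {E : V →ₗ[ℝ] V} {p : V →ₗ[ℝ] K} (hL : ∀ x ∈ L, p x = 0) (hE : ∀ k : K, p (E k) = k)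
    (hsub : ∀ x, x - E (p x) ∈ L) : IsCompl L (K.map E) := by
  constructor
  · rw [Submodule.disjoint_def]
    rintro x hx ⟨k, hk, rfl⟩
    have h1 := hE ⟨k, hk⟩
    rw [hL _ hx] at h1
    have : k = 0 := congrArg Subtype.val h1.symm
    simp [this]
  · rw [codisjoint_iff, eq_top_iff]
    intro x _
    rw [← sub_add_cancel x (E (p x))]
    exact Submodule.add_mem_sup (hsub x) (Submodule.mem_map_of_mem (p x).2)

/-- By uniqueness of the splitting, `E ∘ p` is the projection onto the image of `K` along `L`. This
lets `α` and `β` be read as functions of the `ker B`-coordinate. -/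
lemma map_retraction_of_eq_add {V : Type*} [AddCommGroup V] [Module ℝ V] {K L : Submodule ℝ V}
    {E : V →ₗ[ℝ] V} {p : V →ₗ[ℝ] K} (hL : ∀ x ∈ L, p x = 0) (hE : ∀ k : K, p (E k) = k)
    {x x₁ x₂ : V} (h₁ : x₁ ∈ L) (h₂ : x₂ ∈ K.map E) (hx : x = x₁ + x₂) : E (p x) = x₂ := by
  obtain ⟨k, hk, rfl⟩ := h₂
  rw [hx, map_add, hL _ h₁, zero_add]
  exact congrArg (fun k : K => E k) (hE ⟨k, hk⟩)

section Symplectic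

variable {d : ℕ} {A B C D : Matrix (Fin d) (Fin d) ℝ}

/-- The `ker B`-coordinate of a point in the domain of a metaplectic operator. -/
def kerCoord (B : Matrix (Fin d) (Fin d) ℝ) : Euc d →ₗ[ℝ] matKer B :=
  ((matKer B).orthogonalProjectionOnto).toLinearMap

/-- The `ker B`-coordinate of a point in the target of a metaplectic operator. -/
def kerCoordTarget (B D : Matrix (Fin d) (Fin d) ℝ) : Euc d →ₗ[ℝ] matKer B :=
  kerCoord B ∘ₗ Matrix.toEuclideanLin D.transpose

lemma measurable_kerCoord : Measurable (kerCoord B) :=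
  (LinearMap.continuous_of_finiteDimensional _).measurable

lemma measurable_kerCoordTarget : Measurable (kerCoordTarget B D) :=
  (LinearMap.continuous_of_finiteDimensional _).measurable

lemma kerCoord_eq_zero_iff {x : Euc d} : kerCoord B x = 0 ↔ x ∈ (matKer B)ᗮ :=
  Submodule.orthogonalProjectionOnto_eq_zero_iff

lemma kerCoord_transpose (x : Euc d) : kerCoord B (Matrix.toEuclideanLin B.transpose x) = 0 := by
  rw [kerCoord_eq_zero_iff, orthogonal_matKer]
  exact ⟨x, rfl⟩

lemma kerCoord_coe (k : matKer B) : kerCoord B k = k :=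
  Submodule.orthogonalProjectionOnto_mem_subspace_eq_self k

lemma inner_kerCoord (k : matKer B) (x : Euc d) :
    inner ℝ (kerCoord B x) k = inner ℝ (k : Euc d) x := by
  rw [real_inner_comm]
  exact Submodule.inner_orthogonalProjectionOnto_eq_of_mem_left k x

lemma inner_kerCoordTarget (k : matKer B) (y : Euc d) :
    inner ℝ (kerCoordTarget B D y) k = inner ℝ (Matrix.toEuclideanLin D (k : Euc d)) y := by
  rw [inner_toEuclideanLin_left]
  exact inner_kerCoord k _

/-- The relation `DᵀA = 1 + BᵀC` holds, and the range of `Bᵀ` is orthogonal to `ker B`. -/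
lemma kerCoord_mul_apply
    (hS : Matrix.fromBlocks A B C D ∈ Matrix.symplecticGroup (Fin d) ℝ) (k : matKer B) :
    kerCoord B (Matrix.toEuclideanLin (D.transpose * A) (k : Euc d)) = k := by
  have h := congrArg Matrix.transpose (SymplecticGroup.fromBlocks_mem_iff.1 hS).2.2
  simp only [Matrix.transpose_sub, Matrix.transpose_mul, Matrix.transpose_transpose,
    Matrix.transpose_one] at h
  rw [sub_eq_iff_eq_add.1 h, map_add, LinearMap.add_apply, map_add, toEuclideanLin_mul_apply,
    kerCoord_transpose, add_zero]
  convert kerCoord_coe k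
  simp

lemma kerCoordTarget_apply
    (hS : Matrix.fromBlocks A B C D ∈ Matrix.symplecticGroup (Fin d) ℝ) (k : matKer B) :
    kerCoordTarget B D (Matrix.toEuclideanLin A (k : Euc d)) = k := by
  have := kerCoord_mul_apply hS k
  rwa [toEuclideanLin_mul_apply] at this

/-- Since `DᵀB = BᵀD`, the matrix `Dᵀ` carries `R(B)` into the range of `Bᵀ`, which is `(ker B)ᗮ`.
-/
lemma kerCoordTarget_of_mem_range
    (hS : Matrix.fromBlocks A B C D ∈ Matrix.symplecticGroup (Fin d) ℝ) {y : Euc d}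
    (hy : y ∈ matRange B) : kerCoordTarget B D y = 0 := by
  obtain ⟨x, rfl⟩ := hy
  rw [kerCoordTarget, LinearMap.comp_apply, ← toEuclideanLin_mul_apply,
    ← (SymplecticGroup.fromBlocks_mem_iff.1 hS).2.1, toEuclideanLin_mul_apply, kerCoord_transpose]

lemma sub_mem_orthogonal_matKer
    (hS : Matrix.fromBlocks A B C D ∈ Matrix.symplecticGroup (Fin d) ℝ) (x : Euc d) :
    x - Matrix.toEuclideanLin (D.transpose * A) (kerCoord B x : Euc d) ∈ (matKer B)ᗮ := by
  rw [← kerCoord_eq_zero_iff, map_sub, kerCoord_mul_apply hS, sub_self]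

/-- The transposed matrix is symplectic too, so `y = ADᵀy - BCᵀy`. The part of `Dᵀy` orthogonal to
`ker B` is some `Bᵀv`, and `ABᵀv = BAᵀv` lies in `R(B)`. -/
lemma sub_mem_matRange
    (hS : Matrix.fromBlocks A B C D ∈ Matrix.symplecticGroup (Fin d) ℝ) (y : Euc d) :
    y - Matrix.toEuclideanLin A (kerCoordTarget B D y : Euc d) ∈ matRange B := by
  have hS' := SymplecticGroup.transpose_mem hS
  rw [Matrix.fromBlocks_transpose] at hS'
  obtain ⟨-, -, h3⟩ := SymplecticGroup.fromBlocks_mem_iff.1 hS'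
  obtain ⟨h1, -, -⟩ := SymplecticGroup.fromBlocks_mem_iff.1 hS'
  simp only [Matrix.transpose_transpose] at h1 h3
  set z := Matrix.toEuclideanLin D.transpose y with hz
  have hy : y = Matrix.toEuclideanLin A z -
      Matrix.toEuclideanLin B (Matrix.toEuclideanLin C.transpose y) := by
    rw [hz, ← toEuclideanLin_mul_apply, ← toEuclideanLin_mul_apply, ← LinearMap.sub_apply,
      ← map_sub, h3]
    simp
  have hmem : z - (kerCoord B z : Euc d) ∈ (matKer B)ᗮ := by
    rw [← kerCoord_eq_zero_iff, map_sub, kerCoord_coe, sub_self]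
  rw [orthogonal_matKer] at hmem
  obtain ⟨v, hv⟩ := hmem
  have hAv : Matrix.toEuclideanLin A (z - (kerCoord B z : Euc d)) =
      Matrix.toEuclideanLin B (Matrix.toEuclideanLin A.transpose v) := by
    rw [← hv, ← toEuclideanLin_mul_apply, ← toEuclideanLin_mul_apply, h1]
  have : y - Matrix.toEuclideanLin A (kerCoordTarget B D y : Euc d) =
      Matrix.toEuclideanLin B (Matrix.toEuclideanLin A.transpose v -
        Matrix.toEuclideanLin C.transpose y) := by
    rw [map_sub, ← hAv, map_sub, sub_right_comm, ← hy]
    rfl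
  rw [this]
  exact ⟨_, rfl⟩

lemma isCompl_orthogonal_matKer
    (hS : Matrix.fromBlocks A B C D ∈ Matrix.symplecticGroup (Fin d) ℝ) :
    IsCompl (matKer B)ᗮ (matImage (D.transpose * A) (matKer B)) :=
  isCompl_map_of_retraction (p := kerCoord B) (fun _ => kerCoord_eq_zero_iff.2)
    (kerCoord_mul_apply hS) (sub_mem_orthogonal_matKer hS)

lemma isCompl_matRange
    (hS : Matrix.fromBlocks A B C D ∈ Matrix.symplecticGroup (Fin d) ℝ) :
    IsCompl (matRange B) (matImage A (matKer B)) :=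
  isCompl_map_of_retraction (p := kerCoordTarget B D)
    (fun _ => kerCoordTarget_of_mem_range hS) (kerCoordTarget_apply hS) (sub_mem_matRange hS)

end Symplectic

/-! ### Energy along `ker B` and cutoffs. -/

/-- The measure `|g|² dx`. -/
def energy {d : ℕ} (g : L2Space d) : Measure (Euc d) :=
  volume.withDensity fun x => ((‖g x‖₊ ^ 2 : NNReal) : ENNReal)

lemma measurable_nnnorm_sq {d : ℕ} (g : L2Space d) : Measurable fun x => ‖g x‖₊ ^ 2 :=
  ((Lp.stronglyMeasurable g).measurable.nnnorm).pow_const 2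

instance isFiniteMeasure_energy {d : ℕ} (g : L2Space d) : IsFiniteMeasure (energy g) := by
  refine isFiniteMeasure_withDensity (ne_of_lt ?_)
  have h := lintegral_rpow_enorm_lt_top_of_eLpNorm_lt_top (p := 2) (by norm_num) (by norm_num)
    (Lp.memLp g).2
  refine lt_of_eq_of_lt (lintegral_congr fun x => ?_) h
  simp [enorm_eq_nnnorm]

lemma integral_energy {d : ℕ} (g : L2Space d) (φ : Euc d → ℂ) :
    ∫ x, φ x ∂energy g = ∫ x, g x * starRingEnd ℂ (g x) * φ x := by
  rw [energy, integral_withDensity_eq_integral_smul (measurable_nnnorm_sq g)]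
  refine integral_congr_ae (Filter.Eventually.of_forall fun x => ?_)
  simp only [NNReal.smul_def, NNReal.coe_pow, coe_nnnorm, Complex.real_smul, Complex.mul_conj,
    Complex.normSq_eq_norm_sq]

lemma energy_eq_zero_iff {d : ℕ} (g : L2Space d) {s : Set (Euc d)} (hs : MeasurableSet s) :
    energy g s = 0 ↔ ∀ᵐ x, x ∈ s → g x = 0 := by
  rw [energy, withDensity_apply _ hs,
    lintegral_eq_zero_iff (measurable_nnnorm_sq g).coe_nnreal_ennreal, Filter.EventuallyEq,
    ae_restrict_iff' hs]
  simp

section Metaplectic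

variable {d : ℕ} {A B C D : Matrix (Fin d) (Fin d) ℝ} {T : L2Space d ≃ₗᵢ[ℂ] L2Space d}

/-- A metaplectic operator preserves the distribution of the energy along `ker B`. -/
lemma IsMetaplectic.map_kerCoord_energy (hT : IsMetaplectic (Matrix.fromBlocks A B C D) T)
    (g : L2Space d) :
    (energy g).map (kerCoord B) = (energy (T g)).map (kerCoordTarget B D) := by
  -- For `w ∈ ker B` the weak intertwining relation has no translation, so it equates the
  -- characteristic functions; `w = -t / (2π)` reconciles the two Fourier normalizations.
  refine Measure.ext_of_charFun (funext fun t => ?_)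
  rw [charFun_apply, charFun_apply,
    integral_map measurable_kerCoord.aemeasurable (by fun_prop),
    integral_map measurable_kerCoordTarget.aemeasurable (by fun_prop), integral_energy,
    integral_energy]
  set w : Euc d := (-(2 * Real.pi)⁻¹ : ℝ) • (t : Euc d) with hw
  have ht : (t : Euc d) = (-(2 * Real.pi) : ℝ) • w := by
    rw [hw, smul_smul, neg_mul_neg, mul_inv_cancel₀ (by positivity), one_smul]
  have h := hT.integral_mul_conj_mul_exp g g w
  have hBw : Matrix.toEuclideanLin B w = 0 := by
    rw [hw, map_smul, LinearMap.mem_ker.1 t.2, smul_zero]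
  simp only [hBw, smul_zero, add_zero, sub_zero] at h
  convert h using 5 with x y
  · rw [inner_kerCoord, ht, real_inner_smul_left]
    push_cast
    ring
  · rw [inner_kerCoordTarget, ht, map_smul, real_inner_smul_left]
    push_cast
    ring

lemma IsMetaplectic.ae_eq_zero_of_kerCoord (hT : IsMetaplectic (Matrix.fromBlocks A B C D) T)
    {g : L2Space d} {s : Set (matKer B)} (hs : MeasurableSet s)
    (hg : ∀ᵐ x, kerCoord B x ∈ s → g x = 0) :
    ∀ᵐ y, kerCoordTarget B D y ∈ s → (T g) y = 0 := by
  have h1 := (energy_eq_zero_iff g (measurable_kerCoord hs)).2 hg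
  rw [← Measure.map_apply measurable_kerCoord hs, hT.map_kerCoord_energy,
    Measure.map_apply measurable_kerCoordTarget hs] at h1
  exact (energy_eq_zero_iff (T g) (measurable_kerCoordTarget hs)).1 h1

/-- A metaplectic operator intertwines the cutoffs to a set of `ker B`-coordinates. -/
lemma IsMetaplectic.map_cutoff (hT : IsMetaplectic (Matrix.fromBlocks A B C D) T)
    {f g : L2Space d} {s : Set (matKer B)} (hs : MeasurableSet s)
    (hg : g =ᵐ[volume] (kerCoord B ⁻¹' s).indicator f) :
    T g =ᵐ[volume] (kerCoordTarget B D ⁻¹' s).indicator (T f) := by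
  -- `T` preserves vanishing over sets of `ker B`-coordinates; this is applied to `g` over `sᶜ` and
  -- to `f - g` over `s`.
  have h1 : ∀ᵐ x, kerCoord B x ∈ sᶜ → g x = 0 := by
    filter_upwards [hg] with x hx hxs
    rw [hx, Set.indicator_of_notMem]
    exact hxs
  have h2 : ∀ᵐ x, kerCoord B x ∈ s → (f - g) x = 0 := by
    filter_upwards [hg, Lp.coeFn_sub f g] with x hx hsub hxs
    rw [hsub, Pi.sub_apply, hx, Set.indicator_of_mem (by exact hxs), sub_self]
  have h3 := hT.ae_eq_zero_of_kerCoord hs h2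
  rw [map_sub] at h3
  filter_upwards [hT.ae_eq_zero_of_kerCoord hs.compl h1, h3, Lp.coeFn_sub (T f) (T g)]
    with y hy1 hy2 hy3
  by_cases hy : kerCoordTarget B D y ∈ s
  · rw [Set.indicator_of_mem (by exact hy)]
    have := hy2 hy
    rw [hy3, Pi.sub_apply, sub_eq_zero] at this
    exact this.symm
  · rw [Set.indicator_of_notMem (by exact hy)]
    exact hy1 hy

end Metaplectic

/-! ### Gaussian estimates for semidefinite forms. -/

open scoped MatrixOrder in
/-- A positive semidefinite form is the pullback of the inner product under a linear map. -/
lemma exists_inner_eq_inner_of_posSemidef {d : ℕ} {M : Matrix (Fin d) (Fin d) ℝ}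
    (hM : M.PosSemidef) : ∃ Q : Euc d →ₗ[ℝ] Euc d,
      ∀ x y, inner ℝ (Matrix.toEuclideanLin M x) y = inner ℝ (Q x) (Q y) := by
  obtain ⟨E, rfl⟩ := CStarAlgebra.nonneg_iff_eq_star_mul_self.1 hM.nonneg
  refine ⟨Matrix.toEuclideanLin E, fun x y => ?_⟩
  rw [toEuclideanLin_mul_apply, inner_toEuclideanLin_left,
    Matrix.star_eq_conjTranspose, Matrix.conjTranspose_eq_transpose_of_trivial,
    Matrix.transpose_transpose]

/-- The Gaussian of a positive semidefinite form absorbs exponentials on a neighbourhood of the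
orthogonal complement of the kernel. -/
lemma exists_exp_matQuad_mul_exp_le {d : ℕ} {M : Matrix (Fin d) (Fin d) ℝ} (hM : M.PosSemidef)
    (y : Euc d) {b : ℝ} (hb : matQuad M y < b) (ρ : ℝ) :
    ∃ K c : ℝ, 0 ≤ K ∧ 0 < c ∧ ∀ R : ℝ, 0 ≤ R → ∀ x₁ ∈ (matKer M)ᗮ, ∀ x₂ : Euc d, ‖x₂‖ ≤ ρ →
      Real.exp (-Real.pi * matQuad M x₁) *
          Real.exp (2 * Real.pi * R * |inner ℝ (Matrix.toEuclideanLin M y) (x₁ + x₂)|) ≤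
        K * Real.exp (Real.pi * b * R ^ 2) * Real.exp (-c * ‖x₁ + x₂‖ ^ 2) := by
  obtain ⟨Q, hQ⟩ := exists_inner_eq_inner_of_posSemidef hM
  have hquad : ∀ x, matQuad M x = ‖Q x‖ ^ 2 := fun x => by
    rw [matQuad, hQ, real_inner_self_eq_norm_sq]
  -- The slack is split in two: `b - b'` pays for the bounded displacement `x₂`, and `matQuad M y <
  -- t * b'` with `t < 1` leaves the fraction `1 - t` of the Gaussian as decay in `x₁`.
  obtain ⟨b', hyb', hb'b⟩ := exists_between hb
  have hb' : 0 < b' := lt_of_le_of_lt (by rw [hquad]; positivity) hyb'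
  have hη : 0 < b - b' := by linarith
  obtain ⟨t, ht0, ht1⟩ := exists_between ((div_lt_one hb').2 hyb')
  have hQy0 : 0 ≤ matQuad M y := by rw [hquad]; positivity
  have htpos : 0 < t := lt_of_le_of_lt (div_nonneg hQy0 hb'.le) ht0
  rw [div_lt_iff₀ hb'] at ht0
  -- Coercivity: `Q` is injective on `(ker M)ᗮ`, hence bounded below in finite dimension.
  obtain ⟨m, hm, hlower⟩ : ∃ m : ℝ, 0 < m ∧ ∀ x ∈ (matKer M)ᗮ, m * ‖x‖ ^ 2 ≤ ‖Q x‖ ^ 2 := by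
    have hker : LinearMap.ker (Q.domRestrict (matKer M)ᗮ) = ⊥ := by
      rw [LinearMap.ker_eq_bot']
      rintro ⟨x, hx⟩ hQx
      have hQx' : Q x = 0 := hQx
      have hMx : x ∈ matKer M := by
        refine LinearMap.mem_ker.2 (ext_inner_right ℝ fun z => ?_)
        rw [hQ, hQx', inner_zero_left, inner_zero_left]
      have := Submodule.inner_right_of_mem_orthogonal hMx hx
      rw [Subtype.ext_iff]
      exact inner_self_eq_zero.1 this
    obtain ⟨k, hk, hanti⟩ := LinearMap.exists_antilipschitzWith _ hker
    have hk' : (0 : ℝ) < k := hk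
    refine ⟨((k : ℝ) ^ 2)⁻¹, by positivity, fun x hx => ?_⟩
    have h1 : ‖x‖ ≤ k * ‖Q x‖ := by
      have := hanti.le_mul_dist ⟨x, hx⟩ 0
      simpa using this
    rw [inv_mul_le_iff₀ (by positivity), ← mul_pow]
    gcongr
  set w := Matrix.toEuclideanLin M y with hw
  refine ⟨Real.exp (Real.pi * ((ρ * ‖w‖) ^ 2 / (b - b') + (1 - t) * m * ρ ^ 2)),
    Real.pi * ((1 - t) * m / 2), by positivity, ?_, fun R hR x₁ hx₁ x₂ hx₂ => ?_⟩
  · have : 0 < 1 - t := by linarith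
    positivity
  rw [← Real.exp_add, ← Real.exp_add, ← Real.exp_add, Real.exp_le_exp, hquad]
  have habs : |inner ℝ w (x₁ + x₂)| ≤ ‖Q y‖ * ‖Q x₁‖ + ρ * ‖w‖ := by
    rw [inner_add_right]
    refine (abs_add_le _ _).trans (add_le_add ?_ ?_)
    · rw [hw, hQ]; exact abs_real_inner_le_norm _ _
    · refine (abs_real_inner_le_norm _ _).trans ?_
      rw [mul_comm]
      gcongr
  have hamgm : 2 * R * (‖Q y‖ * ‖Q x₁‖) ≤ t * ‖Q x₁‖ ^ 2 + b' * R ^ 2 := by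
    rw [hquad] at ht0
    have h1 : t * (2 * R * (‖Q y‖ * ‖Q x₁‖)) ≤ t * (t * ‖Q x₁‖ ^ 2 + b' * R ^ 2) := by
      nlinarith [sq_nonneg (t * ‖Q x₁‖ - R * ‖Q y‖),
        mul_le_mul_of_nonneg_right ht0.le (sq_nonneg R)]
    exact le_of_mul_le_mul_left h1 htpos
  have hlin : 2 * R * (ρ * ‖w‖) ≤ (b - b') * R ^ 2 + (ρ * ‖w‖) ^ 2 / (b - b') := by
    have h1 : (b - b') * (2 * R * (ρ * ‖w‖)) ≤
        (b - b') * ((b - b') * R ^ 2 + (ρ * ‖w‖) ^ 2 / (b - b')) := by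
      rw [mul_add, mul_div_cancel₀ _ hη.ne']
      nlinarith [sq_nonneg ((b - b') * R - ρ * ‖w‖)]
    exact le_of_mul_le_mul_left h1 hη
  have hnorm : ‖x₁ + x₂‖ ^ 2 ≤ 2 * ‖x₁‖ ^ 2 + 2 * ρ ^ 2 := by
    have h1 := norm_add_le x₁ x₂
    have h2 : ‖x₁ + x₂‖ ≤ ‖x₁‖ + ρ := by linarith
    have h3 : ‖x₁ + x₂‖ ^ 2 ≤ (‖x₁‖ + ρ) ^ 2 := by gcongr
    nlinarith [sq_nonneg (‖x₁‖ - ρ)]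
  have hlow := mul_le_mul_of_nonneg_left (hlower x₁ hx₁) (by linarith : 0 ≤ 1 - t)
  have hnorm' := mul_le_mul_of_nonneg_left hnorm
    (by have : 0 < 1 - t := by linarith
        positivity : 0 ≤ (1 - t) * m / 2)
  have hR' := mul_le_mul_of_nonneg_left habs (by positivity : 0 ≤ 2 * R)
  have key : -‖Q x₁‖ ^ 2 + 2 * R * |inner ℝ w (x₁ + x₂)| ≤
      ((ρ * ‖w‖) ^ 2 / (b - b') + (1 - t) * m * ρ ^ 2) + b * R ^ 2 -
        (1 - t) * m / 2 * ‖x₁ + x₂‖ ^ 2 := by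
    linarith
  have := mul_le_mul_of_nonneg_left key Real.pi_pos.le
  linarith

/-- Gaussian decay along the line through `v`, uniformly for bounded displacements. -/
lemma exists_exp_matQuad_sub_smul_le {d : ℕ} {N : Matrix (Fin d) (Fin d) ℝ} (hN : N.PosSemidef)
    (v : Euc d) {a : ℝ} (ha : a < matQuad N v) (ρ : ℝ) :
    ∃ K : ℝ, 0 ≤ K ∧ ∀ (s : ℝ) (x : Euc d), ‖x‖ ≤ ρ →
      Real.exp (-Real.pi * matQuad N (x - s • v)) ≤ K * Real.exp (-(Real.pi * a) * s ^ 2) := by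
  obtain ⟨Q, hQ⟩ := exists_inner_eq_inner_of_posSemidef hN
  have hquad : ∀ x, matQuad N x = ‖Q x‖ ^ 2 := fun x => by
    rw [matQuad, hQ, real_inner_self_eq_norm_sq]
  set P := ‖LinearMap.toContinuousLinearMap Q‖ * ρ * ‖Q v‖ with hP
  have hδ : 0 < matQuad N v - a := by linarith
  refine ⟨Real.exp (Real.pi * (P ^ 2 / (matQuad N v - a))), by positivity, fun s x hx => ?_⟩
  rw [← Real.exp_add, Real.exp_le_exp]
  have h1 : matQuad N (x - s • v) = ‖Q x‖ ^ 2 - 2 * (s * inner ℝ (Q x) (Q v)) +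
      s ^ 2 * matQuad N v := by
    rw [hquad, hquad, map_sub, map_smul, norm_sub_sq_real, real_inner_smul_right, norm_smul,
      mul_pow, Real.norm_eq_abs, sq_abs]
  have h2 : s * inner ℝ (Q x) (Q v) ≤ |s| * P := by
    refine (le_abs_self _).trans ?_
    rw [abs_mul]
    gcongr
    refine (abs_real_inner_le_norm _ _).trans ?_
    rw [hP]
    gcongr
    exact ((LinearMap.toContinuousLinearMap Q).le_opNorm x).trans (by gcongr)
  -- The cross term is absorbed by the slack between `a` and `matQuad N v`.
  have h3 : 2 * |s| * P ≤ (matQuad N v - a) * s ^ 2 + P ^ 2 / (matQuad N v - a) := by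
    have h4 : (matQuad N v - a) * (2 * |s| * P) ≤
        (matQuad N v - a) * ((matQuad N v - a) * s ^ 2 + P ^ 2 / (matQuad N v - a)) := by
      rw [mul_add, mul_div_cancel₀ _ hδ.ne', ← sq_abs s]
      nlinarith [sq_nonneg ((matQuad N v - a) * |s| - P)]
    exact le_of_mul_le_mul_left h4 hδ
  have key : -matQuad N (x - s • v) ≤ P ^ 2 / (matQuad N v - a) - a * s ^ 2 := by
    rw [h1]
    nlinarith [sq_nonneg ‖Q x‖]
  have := mul_le_mul_of_nonneg_left key Real.pi_pos.le
  linarith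

/-! ### Hardy's principle for a metaplectic operator along one direction. -/

/-- Gaussian bounds on `g` and on `T g` along a direction `w` that violate Hardy's uncertainty
principle force `T g` to vanish. -/
lemma IsMetaplectic.ae_eq_zero_of_gaussian_bounds {d : ℕ} {A B C D : Matrix (Fin d) (Fin d) ℝ}
    {T : L2Space d ≃ₗᵢ[ℂ] L2Space d} (hT : IsMetaplectic (Matrix.fromBlocks A B C D) T)
    {g : L2Space d} {w : Euc d} {a b c K L : ℝ} (hb : 0 ≤ b) (hba : b < a) (hc : 0 < c)
    (hg : ∀ R : ℝ, 0 ≤ R → ∀ᵐ x : Euc d, ‖g x‖ * Real.exp (2 * Real.pi * R * |inner ℝ w x|) ≤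
      K * Real.exp (b * R ^ 2) * Real.exp (-c * ‖x‖ ^ 2))
    {F : Set (Euc d)} (hF : MeasurableSet F) (hFfin : volume F < ⊤)
    (hTg : ∀ s : ℝ, ∀ᵐ y : Euc d, y ∈ F →
      ‖(T g) (y - s • Matrix.toEuclideanLin B w)‖ ≤ L * Real.exp (-a * s ^ 2)) :
    ∀ᵐ y : Euc d, y ∈ F → (T g) y = 0 := by
  -- The test function is `h = T⁻¹ (1_F · T g)`. Finite measure of `F` puts `T h` in `L¹`, so a
  -- pointwise bound on shifts of `T g` suffices.
  have hmem : MemLp (F.indicator (T g)) 2 volume := (Lp.memLp (T g)).indicator hF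
  set u : L2Space d := hmem.toLp with hu
  have hucoe : u =ᵐ[volume] F.indicator (T g) := hmem.coeFn_toLp
  have huint : Integrable u := by
    refine Integrable.congr ?_ hucoe.symm
    rw [integrable_indicator_iff hF]
    have : IsFiniteMeasure (volume.restrict F) := ⟨by simpa using hFfin⟩
    exact ((Lp.memLp (T g)).restrict F).integrable (by norm_num)
  set h : L2Space d := T.symm u with hh
  have hTh : T h = u := T.apply_symm_apply u
  set ρ : Euc d → ℂ := fun x => h x * starRingEnd ℂ (g x) with hρ
  have hρmeas : AEStronglyMeasurable ρ volume :=
    (Lp.aestronglyMeasurable h).mul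
      (RCLike.continuous_conj.comp_aestronglyMeasurable (Lp.aestronglyMeasurable g))
  have hρbound : ∀ R : ℝ, 0 ≤ R → ∀ᵐ x : Euc d,
      ‖ρ x‖ * Real.exp (2 * Real.pi * R * |inner ℝ w x|) ≤
        K * Real.exp (b * R ^ 2) * (Real.exp (-c * ‖x‖ ^ 2) * ‖h x‖) := by
    intro R hR
    filter_upwards [hg R hR] with x hx
    have := mul_le_mul_of_nonneg_right hx (norm_nonneg (h x))
    simp only [hρ, norm_mul, RCLike.norm_conj]
    linarith
  have hgauss := integrable_exp_neg_mul_norm_sq_mul_norm hc h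
  have hmeasl : Measurable fun x : Euc d => (inner ℝ w x : ℝ) := by fun_prop
  have hdiff := differentiable_integral_mul_cexp (μ := volume) hρmeas hmeasl (fun R => by
    refine (hgauss.const_mul (K * Real.exp (b * (|R| / (2 * Real.pi)) ^ 2))).mono'
      (hρmeas.norm.mul (by fun_prop)) ?_
    filter_upwards [hρbound (|R| / (2 * Real.pi)) (by positivity)] with x hx
    rw [Real.norm_of_nonneg (by positivity)]
    refine le_trans ?_ hx
    rw [mul_div_cancel₀ _ (by positivity : 2 * Real.pi ≠ 0)]
    gcongr
    exact le_abs_self R)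
  set Φ : ℂ → ℂ := fun z =>
    ∫ x, ρ x * Complex.exp (-2 * Real.pi * Complex.I * (z * (inner ℝ w x : ℝ))) with hΦ
  set J : ℝ := ∫ x : Euc d, Real.exp (-c * ‖x‖ ^ 2) * ‖h x‖ with hJ
  set U : ℝ := ∫ y : Euc d, ‖u y‖ with hU
  have hgrowth : ∀ z : ℂ, ‖Φ z‖ ≤ K * J * Real.exp (b * z.im ^ 2) := by
    intro z
    have h1 := norm_integral_le_of_norm_le
      (f := fun x => ρ x * Complex.exp (-2 * Real.pi * Complex.I * (z * (inner ℝ w x : ℝ))))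
      (hgauss.const_mul (K * Real.exp (b * |z.im| ^ 2))) (by
        filter_upwards [hρbound |z.im| (abs_nonneg _)] with x hx
        rw [norm_mul, Complex.norm_exp]
        refine le_trans ?_ hx
        gcongr
        have h2 : (-2 * Real.pi * Complex.I * (z * (inner ℝ w x : ℝ))).re =
            2 * Real.pi * (z.im * inner ℝ w x) := by
          simp
        rw [h2, mul_assoc (2 * Real.pi) |z.im|, ← abs_mul]
        gcongr
        exact le_abs_self _)
    rw [integral_const_mul, sq_abs] at h1
    refine h1.trans_eq ?_
    ring
  have hreal : ∀ s : ℝ, ‖Φ s‖ ≤ L * U * Real.exp (-a * s ^ 2) := by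
    intro s
    set v : Euc d := (1 / 2 : ℝ) • Matrix.toEuclideanLin B (s • w) with hv
    have h1 : Φ s = ∫ y : Euc d, u (y + v) * starRingEnd ℂ ((T g) (y - v)) *
        Complex.exp (-2 * Real.pi * Complex.I *
          (inner ℝ (Matrix.toEuclideanLin D (s • w)) y : ℝ)) := by
      rw [← hTh, ← hT.integral_mul_conj_mul_exp h g (s • w)]
      simp only [hΦ, hρ, real_inner_smul_left, Complex.ofReal_mul]
    have h2 := norm_integral_le_of_norm_le
      (f := fun y => u (y + v) * starRingEnd ℂ ((T g) (y - v)) *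
        Complex.exp (-2 * Real.pi * Complex.I *
          (inner ℝ (Matrix.toEuclideanLin D (s • w)) y : ℝ)))
      ((huint.norm.comp_add_right v).const_mul (L * Real.exp (-a * s ^ 2))) (by
        have hshift := (measurePreserving_add_right (volume : Measure (Euc d)) v)
          |>.quasiMeasurePreserving
        filter_upwards [hshift.ae (hTg s), hshift.ae hucoe] with y hy1 hy2
        have hexp : ‖Complex.exp (-2 * Real.pi * Complex.I *
            (inner ℝ (Matrix.toEuclideanLin D (s • w)) y : ℝ))‖ = 1 := by
          rw [Complex.norm_exp]
          simp
        rw [norm_mul, norm_mul, hexp, mul_one, RCLike.norm_conj]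
        -- The two opposite half-shifts combine: seen from a point of `F`, `T g` is displaced by the
        -- full `s Bw`.
        have hsub : y + v - s • Matrix.toEuclideanLin B w = y - v := by
          rw [hv, map_smul]
          module
        by_cases hyF : y + v ∈ F
        · have := hy1 hyF
          rw [hsub] at this
          rw [mul_comm]
          gcongr
        · rw [hy2, Set.indicator_of_notMem hyF]
          simp)
    rw [h1]
    refine h2.trans_eq ?_
    rw [integral_const_mul, integral_add_right_eq_self (fun y => ‖u y‖)]
    ring
  have hzero : Φ 0 = 0 := by
    refine eq_zero_of_gaussian_bounds (K := max (K * J) (L * U)) hdiff hb hba (fun s => ?_)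
      fun z => ?_
    · exact (hreal s).trans (by gcongr; exact le_max_right _ _)
    · exact (hgrowth z).trans (by gcongr; exact le_max_left _ _)
  -- `Φ 0` is the inner product of `g` and `h`, which unitarity turns into that of `T g` and `u`,
  -- and this is the squared norm of `u`.
  have hinner : inner ℂ u u = (0 : ℂ) := by
    have h1 : inner ℂ g h = (0 : ℂ) := by
      rw [L2.inner_def, ← hzero]
      simp [hΦ, hρ, mul_comm]
    rw [← T.inner_map_map, hTh, L2.inner_def] at h1
    rw [← h1, L2.inner_def]
    refine integral_congr_ae ?_
    filter_upwards [hucoe] with y hy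
    by_cases hyF : y ∈ F
    · rw [hy, Set.indicator_of_mem hyF]
    · rw [hy, Set.indicator_of_notMem hyF, inner_zero_right, inner_zero_right]
  have hu0 : u = 0 := inner_self_eq_zero.1 hinner
  rw [hu0] at hucoe
  filter_upwards [hucoe, Lp.coeFn_zero ℂ 2 (volume : Measure (Euc d))] with y hy1 hy2 hyF
  rw [Set.indicator_of_mem hyF] at hy1
  rw [← hy1, hy2, Pi.zero_apply]

/-! ### Slice bounds and the eigenvalue condition. -/

lemma norm_le_mul_of_enorm_le {z : ℂ} {α : ENNReal} {n : ℕ} {t : ℝ} (ht : 0 ≤ t)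
    (hα : α ≤ n) (hz : ‖z‖ₑ ≤ α * ENNReal.ofReal t) : ‖z‖ ≤ n * t := by
  have h : ‖z‖ₑ ≤ ENNReal.ofReal (n * t) := by
    rw [ENNReal.ofReal_mul (by positivity), ENNReal.ofReal_natCast]
    exact hz.trans (by gcongr)
  rw [← ofReal_norm] at h
  exact (ENNReal.ofReal_le_ofReal_iff (by positivity)).1 h

lemma continuous_matQuad {d : ℕ} (M : Matrix (Fin d) (Fin d) ℝ) : Continuous (matQuad M) := by
  unfold matQuad
  exact (LinearMap.continuous_of_finiteDimensional _).inner continuous_id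

/-- Gaussian bounds on almost all slices parallel to `L₁`, as a bound almost everywhere. -/
lemma ae_exists_gaussian_bound {d : ℕ} {L₁ L₂ : Submodule ℝ (Euc d)} (h : IsCompl L₁ L₂)
    {u : L2Space d} {M : Matrix (Fin d) (Fin d) ℝ} {α : L₂ → ENNReal} (hα : Measurable α)
    (hα_fin : ∀ᵐ x₂ ∂lebesgueOn L₂, α x₂ < ⊤)
    (hu : ∀ᵐ x₂ : L₂ ∂lebesgueOn L₂, ∀ᵐ x₁ : L₁ ∂lebesgueOn L₁,
      ‖u ((x₁ : Euc d) + (x₂ : Euc d))‖ₑ ≤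
        α x₂ * ENNReal.ofReal (Real.exp (-Real.pi * matQuad M x₁))) :
    ∀ᵐ x : Euc d, ∃ (x₁ : L₁) (x₂ : L₂), x = (x₁ : Euc d) + (x₂ : Euc d) ∧ α x₂ < ⊤ ∧
      ‖u ((x₁ : Euc d) + (x₂ : Euc d))‖ₑ ≤
        α x₂ * ENNReal.ofReal (Real.exp (-Real.pi * matQuad M x₁)) := by
  have hleft : Measurable fun z : L₂ × L₁ => ‖u ((z.2 : Euc d) + (z.1 : Euc d))‖ₑ :=
    ((Lp.stronglyMeasurable u).measurable.comp (by fun_prop)).enorm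
  have hright : Measurable fun z : L₂ × L₁ =>
      α z.1 * ENNReal.ofReal (Real.exp (-Real.pi * matQuad M z.2)) := by
    have := (continuous_matQuad M).measurable
    fun_prop
  have hfin : MeasurableSet {z : L₂ × L₁ | α z.1 < ⊤} :=
    measurableSet_lt (hα.comp measurable_fst) measurable_const
  refine ae_exists_add_of_isCompl h
    (p := fun x₂ x₁ => α x₂ < ⊤ ∧ ‖u ((x₁ : Euc d) + (x₂ : Euc d))‖ₑ ≤
      α x₂ * ENNReal.ofReal (Real.exp (-Real.pi * matQuad M x₁)))
    (hfin.inter (measurableSet_le hleft hright)) ?_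
  filter_upwards [hu, hα_fin] with x₂ h1 h2
  filter_upwards [h1] with x₁ h3 using ⟨h2, h3⟩

/-- An eigenvector of `M Bᵀ N B` with eigenvalue larger than one, rewritten as a strict inequality
between quadratic forms. -/
lemma exists_matQuad_lt_of_hasEigenvalue {d : ℕ} {B M N : Matrix (Fin d) (Fin d) ℝ}
    (hM : M.PosSemidef) {lam : ℝ} (hlam : 1 < lam)
    (heig : Module.End.HasEigenvalue (Matrix.toLin' (M * B.transpose * N * B)) lam) :
    ∃ y : Euc d, 0 ≤ matQuad M y ∧
      matQuad M y < matQuad N (Matrix.toEuclideanLin B (Matrix.toEuclideanLin M y)) := by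
  obtain ⟨v, hv⟩ := heig.exists_hasEigenvector
  set w : Euc d := WithLp.toLp 2 v with hw
  have hw0 : w ≠ 0 := fun h => hv.2 (by simpa [hw] using h)
  -- With `z = BᵀNBw` the eigenvalue equation reads `Mz = λw`. So `y = λ⁻¹z` has `My = w` and `My·y
  -- = λ⁻¹ N(Bw)·(Bw)`, which is positive because `w ≠ 0`.
  set z : Euc d := Matrix.toEuclideanLin B.transpose
    (Matrix.toEuclideanLin N (Matrix.toEuclideanLin B w)) with hz
  have hMz : Matrix.toEuclideanLin M z = lam • w := by
    rw [hz, ← toEuclideanLin_mul_apply, ← toEuclideanLin_mul_apply, ← toEuclideanLin_mul_apply]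
    have := hv.apply_eq_smul
    rw [Matrix.toLin'_apply] at this
    rw [hw, Matrix.toLpLin_apply, this]
    rfl
  have hlam0 : 0 < lam := by linarith
  have hMy : Matrix.toEuclideanLin M (lam⁻¹ • z) = w := by
    rw [map_smul, hMz, smul_smul, inv_mul_cancel₀ hlam0.ne', one_smul]
  have hval : matQuad M (lam⁻¹ • z) = lam⁻¹ * matQuad N (Matrix.toEuclideanLin B w) := by
    rw [matQuad, hMy, real_inner_smul_right, hz, ← inner_toEuclideanLin_left, matQuad,
      real_inner_comm]
  obtain ⟨Q, hQ⟩ := exists_inner_eq_inner_of_posSemidef hM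
  have hpos : 0 < matQuad M (lam⁻¹ • z) := by
    rw [matQuad, hQ, real_inner_self_eq_norm_sq]
    have hne : Q (lam⁻¹ • z) ≠ 0 := by
      intro h0
      refine hw0 (ext_inner_right ℝ fun x => ?_)
      rw [← hMy, hQ, h0, inner_zero_left, inner_zero_left]
    positivity
  refine ⟨lam⁻¹ • z, hpos.le, ?_⟩
  rw [hMy]
  rw [hval] at hpos ⊢
  have hq := pos_of_mul_pos_right hpos (inv_pos.2 hlam0).le
  exact mul_lt_of_lt_one_left hq (inv_lt_one_of_one_lt₀ hlam)

end

/-! ### Conclusion by cutoff and exhaustion. -/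

theorem mainTheorem2 {d : ℕ} (A B C D : Matrix (Fin d) (Fin d) ℝ)
    (T : L2Space d ≃ₗᵢ[ℂ] L2Space d)
    (hT : IsMetaplectic (Matrix.fromBlocks A B C D) T)
    (hB : 1 ≤ B.rank)
    (M N : Matrix (Fin d) (Fin d) ℝ) (hM : M.PosSemidef) (hN : N.PosSemidef)
    (hMB : matKer M = matKer B) (hNB : matRange N = matRange B)
    (f : L2Space d)
    (α : matImage (D.transpose * A) (matKer B) → ENNReal)
    (β : matImage A (matKer B) → ENNReal)
    (hα : Measurable α) (hα_fin : ∀ᵐ x₂ ∂lebesgueOn (matImage (D.transpose * A) (matKer B)),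
      α x₂ < ⊤)
    (hβ : Measurable β) (hβ_fin : ∀ᵐ ξ₂ ∂lebesgueOn (matImage A (matKer B)), β ξ₂ < ⊤)
    (hf : ∀ᵐ x₂ : matImage (D.transpose * A) (matKer B)
        ∂lebesgueOn (matImage (D.transpose * A) (matKer B)),
      ∀ᵐ x₁ : (matKer B)ᗮ ∂lebesgueOn (matKer B)ᗮ,
        ‖f ((x₁ : Euc d) + (x₂ : Euc d))‖ₑ ≤
          α x₂ * ENNReal.ofReal (Real.exp (-Real.pi * matQuad M x₁)))
    (hTf : ∀ᵐ ξ₂ : matImage A (matKer B) ∂lebesgueOn (matImage A (matKer B)),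
      ∀ᵐ ξ₁ : matRange B ∂lebesgueOn (matRange B),
        ‖(T f) ((ξ₁ : Euc d) + (ξ₂ : Euc d))‖ₑ ≤
          β ξ₂ * ENNReal.ofReal (Real.exp (-Real.pi * matQuad N ξ₁)))
    (hlam : ∃ lam : ℝ, 1 < lam ∧
      Module.End.HasEigenvalue (Matrix.toLin' (M * B.transpose * N * B)) lam) :
    (f : Euc d → ℂ) =ᵐ[volume] 0 := by
  have hS := hT.1
  obtain ⟨lam, hlam1, heig⟩ := hlam
  obtain ⟨y₀, hy₀, hlt⟩ := exists_matQuad_lt_of_hasEigenvalue hM hlam1 heig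
  set w : Euc d := Matrix.toEuclideanLin M y₀ with hw
  obtain ⟨b, hyb, hb⟩ := exists_between hlt
  obtain ⟨a, hba, haq⟩ := exists_between hb
  have hf' := ae_exists_gaussian_bound (isCompl_orthogonal_matKer hS) hα hα_fin hf
  have hTf' := ae_exists_gaussian_bound (isCompl_matRange hS) hβ hβ_fin hTf
  let ι : matKer B → matImage (D.transpose * A) (matKer B) := fun k =>
    ⟨Matrix.toEuclideanLin (D.transpose * A) (k : Euc d), Submodule.mem_map_of_mem k.2⟩
  let ι' : matKer B → matImage A (matKer B) := fun k =>
    ⟨Matrix.toEuclideanLin A (k : Euc d), Submodule.mem_map_of_mem k.2⟩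
  have hι : Measurable ι := Measurable.subtype_mk
    (((LinearMap.continuous_of_finiteDimensional _).comp continuous_subtype_val).measurable)
  have hι' : Measurable ι' := Measurable.subtype_mk
    (((LinearMap.continuous_of_finiteDimensional _).comp continuous_subtype_val).measurable)
  have hfι : ∀ (x : Euc d) (x₁ : (matKer B)ᗮ) (x₂ : matImage (D.transpose * A) (matKer B)),
      x = (x₁ : Euc d) + (x₂ : Euc d) → ι (kerCoord B x) = x₂ := fun x x₁ x₂ hx =>
    Subtype.ext (map_retraction_of_eq_add (p := kerCoord B) (fun _ => kerCoord_eq_zero_iff.2)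
      (kerCoord_mul_apply hS) x₁.2 x₂.2 hx)
  have hTfι : ∀ (x : Euc d) (x₁ : matRange B) (x₂ : matImage A (matKer B)),
      x = (x₁ : Euc d) + (x₂ : Euc d) → ι' (kerCoordTarget B D x) = x₂ := fun x x₁ x₂ hx =>
    Subtype.ext (map_retraction_of_eq_add (p := kerCoordTarget B D)
      (fun _ => kerCoordTarget_of_mem_range hS) (kerCoordTarget_apply hS) x₁.2 x₂.2 hx)
  have claim : ∀ n : ℕ, ∀ᵐ x : Euc d,
      α (ι (kerCoord B x)) ≤ n ∧ ‖(ι (kerCoord B x) : Euc d)‖ ≤ n → f x = 0 := by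
    intro n
    -- Both conditions depend only on the `ker B`-coordinate, so `T` respects the cutoff. The first
    -- makes `α` bounded, the second bounds the displacement `x₂` in the Gaussian estimate.
    set s : Set (matKer B) := {k | α (ι k) ≤ n ∧ ‖(ι k : Euc d)‖ ≤ n} with hs
    have hsm : MeasurableSet s := (measurableSet_le (hα.comp hι) measurable_const).inter
      (measurableSet_le (measurable_subtype_coe.comp hι).norm measurable_const)
    have hmem : MemLp ((kerCoord B ⁻¹' s).indicator f) 2 volume :=
      (Lp.memLp f).indicator (measurable_kerCoord hsm)
    set g : L2Space d := hmem.toLp with hgdef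
    have hg : g =ᵐ[volume] (kerCoord B ⁻¹' s).indicator f := hmem.coeFn_toLp
    have hTg := hT.map_cutoff hsm hg
    obtain ⟨K, c, hK, hc, hbound⟩ := exists_exp_matQuad_mul_exp_le hM y₀ hyb n
    have hgrowth : ∀ R : ℝ, 0 ≤ R → ∀ᵐ x : Euc d,
        ‖g x‖ * Real.exp (2 * Real.pi * R * |inner ℝ w x|) ≤
          (n * K) * Real.exp ((Real.pi * b) * R ^ 2) * Real.exp (-c * ‖x‖ ^ 2) := by
      intro R hR
      filter_upwards [hg, hf'] with x hgx ⟨x₁, x₂, hx, _, hx₃⟩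
      by_cases hxs : kerCoord B x ∈ s
      · rw [hgx, Set.indicator_of_mem (by exact hxs)]
        obtain ⟨hs1, hs2⟩ := hxs
        rw [hfι x x₁ x₂ hx] at hs1 hs2
        rw [← hx] at hx₃
        have h1 := norm_le_mul_of_enorm_le (Real.exp_nonneg _) hs1 hx₃
        have h2 := hbound R hR x₁ (by rw [hMB]; exact x₁.2) x₂ hs2
        rw [← hx] at h2
        calc _ ≤ (n * Real.exp (-Real.pi * matQuad M x₁)) *
              Real.exp (2 * Real.pi * R * |inner ℝ w x|) := by gcongr
          _ = n * (Real.exp (-Real.pi * matQuad M x₁) *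
              Real.exp (2 * Real.pi * R * |inner ℝ w x|)) := by ring
          _ ≤ n * (K * Real.exp (Real.pi * b * R ^ 2) * Real.exp (-c * ‖x‖ ^ 2)) := by gcongr
          _ = _ := by ring
      · rw [hgx, Set.indicator_of_notMem (by exact hxs), norm_zero, zero_mul]
        positivity
    have hvanish : ∀ m : ℕ, ∀ᵐ y : Euc d,
        β (ι' (kerCoordTarget B D y)) ≤ m ∧ ‖y‖ ≤ m → (T g) y = 0 := by
      intro m
      set F : Set (Euc d) := {y | β (ι' (kerCoordTarget B D y)) ≤ m ∧ ‖y‖ ≤ m} with hF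
      have hFm : MeasurableSet F := (measurableSet_le
        (hβ.comp (hι'.comp measurable_kerCoordTarget)) measurable_const).inter
        (measurableSet_le measurable_norm measurable_const)
      have hFfin : volume F < ⊤ := by
        refine lt_of_le_of_lt (measure_mono fun y hy => ?_)
          (measure_closedBall_lt_top (x := (0 : Euc d)) (r := m))
        simpa using hy.2
      -- `E` is the projection onto `R(B)` along `A(ker B)`; its norm bounds the `R(B)`-component
      -- over `F`.
      set E : Euc d →L[ℝ] Euc d := LinearMap.toContinuousLinearMap
        (LinearMap.id - Matrix.toEuclideanLin A ∘ₗ (matKer B).subtype ∘ₗ kerCoordTarget B D)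
        with hE
      obtain ⟨L, hL, hdecay⟩ := exists_exp_matQuad_sub_smul_le hN (Matrix.toEuclideanLin B w) haq
        (‖E‖ * m)
      refine hT.ae_eq_zero_of_gaussian_bounds (a := Real.pi * a) (b := Real.pi * b) (L := m * L)
        (by have := hy₀.trans hyb.le
            positivity) (by gcongr) hc hgrowth hFm hFfin fun t => ?_
      have hshift := (measurePreserving_sub_right (volume : Measure (Euc d))
        (t • Matrix.toEuclideanLin B w)).quasiMeasurePreserving
      filter_upwards [hshift.ae hTg, hshift.ae hTf'] with y hy ⟨ξ₁, ξ₂, hξ, _, hξ₃⟩ hyF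
      -- Shifts along `Bw` do not change the `ker B`-coordinate, so the bound `β ≤ m` on `F`
      -- persists at the shifted point.
      have hcoord : kerCoordTarget B D (y - t • Matrix.toEuclideanLin B w) =
          kerCoordTarget B D y := by
        rw [map_sub, map_smul, kerCoordTarget_of_mem_range hS ⟨w, rfl⟩, smul_zero, sub_zero]
      have hξ₂ := hTfι _ ξ₁ ξ₂ hξ
      rw [hcoord] at hξ₂
      have hξ₁ : (ξ₁ : Euc d) = E y - t • Matrix.toEuclideanLin B w := by
        have h1 : E y = y - (ξ₂ : Euc d) := by rw [← hξ₂]; rfl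
        rw [h1, eq_sub_of_add_eq hξ.symm]
        abel
      have h1 : ‖(T g) (y - t • Matrix.toEuclideanLin B w)‖ ≤
          ‖(T f) (y - t • Matrix.toEuclideanLin B w)‖ := by
        rw [hy]
        exact norm_indicator_le_norm_self _ _
      obtain ⟨hyF1, hyF2⟩ := hyF
      rw [hξ₂] at hyF1
      rw [← hξ] at hξ₃
      have h2 := norm_le_mul_of_enorm_le (Real.exp_nonneg _) hyF1 hξ₃
      rw [hξ₁] at h2
      have h3 := hdecay t (E y) ((E.le_opNorm y).trans (by gcongr))
      calc _ ≤ _ := h1.trans h2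
        _ ≤ m * (L * Real.exp (-(Real.pi * a) * t ^ 2)) := by gcongr
        _ = _ := by ring
    have hTg0 : T g = 0 := by
      refine Lp.ext ?_
      filter_upwards [ae_all_iff.2 hvanish, hTf', Lp.coeFn_zero ℂ 2 (volume : Measure (Euc d))]
        with y hy ⟨ξ₁, ξ₂, hξ, hfin, _⟩ h0
      rw [h0, Pi.zero_apply]
      -- As `β` is finite almost everywhere, the sets `F` exhaust space up to a null set.
      obtain ⟨m₁, hm₁⟩ := ENNReal.exists_nat_gt hfin.ne
      obtain ⟨m₂, hm₂⟩ := exists_nat_ge ‖y‖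
      refine hy (max m₁ m₂) ⟨?_, ?_⟩
      · rw [hTfι y ξ₁ ξ₂ hξ]
        exact hm₁.le.trans (by gcongr; exact le_max_left _ _)
      · exact hm₂.trans (by gcongr; exact le_max_right _ _)
    have hg0 : g = 0 := by simpa using hTg0
    rw [hg0] at hg
    filter_upwards [hg, Lp.coeFn_zero ℂ 2 (volume : Measure (Euc d))] with x hx h0 hxs
    rw [h0, Set.indicator_of_mem (by exact hxs)] at hx
    exact hx.symm
  filter_upwards [ae_all_iff.2 claim, hf'] with x hx ⟨x₁, x₂, hxx, hfin, _⟩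
  obtain ⟨m₁, hm₁⟩ := ENNReal.exists_nat_gt hfin.ne
  obtain ⟨m₂, hm₂⟩ := exists_nat_ge ‖(x₂ : Euc d)‖
  refine hx (max m₁ m₂) ?_
  rw [hfι x x₁ x₂ hxx]
  exact ⟨hm₁.le.trans (by gcongr; exact le_max_left _ _),
    hm₂.trans (by gcongr; exact le_max_right _ _)⟩
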